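/- Let $R$ be a commutative ring with unit containing $\mathbb{Q}$, let $n\ge 0$, and let $G=(G_1,\dots,G_n)$ be power series in $R[[u_1,\dots,u_n]]$. For $X=(X_1,\dots,X_n)$, $u=(u_1,\dots,u_n)$, $\overline u=(\overline u_1,\dots,\overline u_n)$ independent indeterminates, the formal Gaussian integral (with identity covariance) of a monomial is $$\int d\overline u\,du\; e^{-\overline u u}\,\overline u^{\alpha_1}u^{\alpha_2}=\sum_{\sigma}\prod_{k=1}^{|\alpha_1|}\delta_{\tau_2(\sigma(k)),\,\tau_1(k)}\in R,$$ where, for $i=1,2$, $\tau_i:\{1,\dots,|\alpha_i|\}\to\{1,\dots,n\}$ is any map taking each value $j$ exactly $(\alpha_i)_j$ times and $\sigma$ runs over all bijections $\{1,\dots,|\alpha_1|\}\to\{1,\dots,|\alpha_2|\}$. For $U=\sum c_{\alpha_1,\alpha_2,\alpha_3}\overline u^{\alpha_1}u^{\alpha_2}X^{\alpha_3}\in R[[\overline u,u,X]]$ put $$\int d\overline u\,du\; e^{-\overline u u}\,U=\sum_{\alpha_1,\alpha_2,\alpha_3}c_{\alpha_1,\alpha_2,\alpha_3}X^{\alpha_3}\int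 d\overline u\,du\; e^{-\overline u u}\,\overline u^{\alpha_1}u^{\alpha_2}\in R[[X]],$$ which is said to be well defined if for each $\alpha_3$ only finitely many $(\alpha_1,\alpha_2)$ give a nonzero contribution. Write $\overline uXG(u)=\sum_i\overline u_iX_iG_i(u)$, and for multi-indices $\alpha$ write $\alpha!=\prod_i\alpha_i!$, $G(u)^\alpha=\prod_iG_i(u)^{\alpha_i}$. Then there is a unique system $F=(F_1,\dots,F_n)$ of power series in $R[[X_1,\dots,X_n]]$ without constant term such that $F_i=X_i\,G_i(F)$ for $1\le i\le n$. The determinant of the matrix $I-X\partial G(F)=\big(\delta_{ij}-X_i(\partial_jG_i)(F)\big)_{1\le i,j\le n}$ is invertible in $R[[X]]$, and for every monomial $\Omega(u)=u_1^{\beta_1}\cdots u_n^{\beta_n}$ the integral below is well defined and $$\Omega(F)\cdot\frac1{\det\big(I-X\partial G(F)\big)}=\int d\overline u\,du\; e^{-\overline u u}\,\Omega(u)\,e^{\overline uXG(u)}\quad\text{in }R[[X]].$$ Moreover, for every $\alpha\in\mathbb{N}^n$ the integral $\int d\overline u\,du\,e^{-\overline uu}\,\overline u^\alpha\Omega(u)G(u)^\alpha$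 is well defined and equals $\left.\left(\frac{\partial}{\partial u}\right)^{\alpha}\right|_{u=0}\left[\Omega(u)G(u)^\alpha\right]\in R$, and, with a summable right-hand side, $$\int d\overline u\,du\; e^{-\overline u u}\,\Omega(u)\,e^{\overline uXG(u)}=\sum_{\alpha\in\mathbb{N}^n}\frac{X^\alpha}{\alpha!}\left.\left(\frac{\partial}{\partial u}\right)^{\alpha}\right|_{u=0}\left[\Omega(u)G(u)^\alpha\right].$$ -/

import Mathlib

namespace LagrangeGood

/-- Index type of the three vectors of indeterminates `ū`, `u`, `X`, in this order. -/
abbrev Var (n : ℕ) : Type := Fin n ⊕ Fin n ⊕ Fin n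

/-- The position of `ū_i`. -/
def Var.ubar {n : ℕ} (i : Fin n) : Var n := Sum.inl i

/-- The position of `u_i`. -/
def Var.u {n : ℕ} (i : Fin n) : Var n := Sum.inr (Sum.inl i)

/-- The position of `X_i`. -/
def Var.x {n : ℕ} (i : Fin n) : Var n := Sum.inr (Sum.inr i)

/-- The exponent of the monomial `ū^α₁ u^α₂ X^α₃`. -/
noncomputable def triple {n : ℕ} (α₁ α₂ α₃ : Fin n →₀ ℕ) : Var n →₀ ℕ :=
  Finsupp.sumElim α₁ (Finsupp.sumElim α₂ α₃)

/-- Multiindex power `F^α = F_1^{α_1} ⋯ F_n^{α_n}`. -/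
def mpow {n : ℕ} {S : Type*} [CommMonoid S] (F : Fin n → S) (α : Fin n →₀ ℕ) : S :=
  ∏ i, F i ^ α i

/-- `α! = α_1! ⋯ α_n!`. -/
def mfactorial {n : ℕ} (α : Fin n →₀ ℕ) : ℕ := ∏ i, (α i).factorial

section Sums

variable {R : Type*} [CommRing R] {σ ι : Type*}

/-- A family of power series is summable (`R` being discrete) if every monomial occurs with a
nonzero coefficient in only finitely many members. -/
def FormallySummable (f : ι → MvPowerSeries σ R) : Prop :=
  ∀ d : σ →₀ ℕ, {i | MvPowerSeries.coeff d (f i) ≠ 0}.Finite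

/-- The sum of a summable family of power series, coefficient by coefficient. -/
noncomputable def formalSum (f : ι → MvPowerSeries σ R) : MvPowerSeries σ R :=
  fun d => ∑ᶠ i, MvPowerSeries.coeff d (f i)

end Sums

section Gaussian

variable {R : Type*} [CommRing R] {n : ℕ}

/-- The sum over all pairings `s : ι ≃ κ` of the products of the covariances
`[A⁻¹]_{τ₂(s(k)) τ₁(k)}`. -/
noncomputable def wickSum (A : Matrix.GeneralLinearGroup (Fin n) R)
    {ι κ : Type*} [Fintype ι] [Fintype κ] [DecidableEq ι] [DecidableEq κ]
    (τ₁ : ι → Fin n) (τ₂ : κ → Fin n) : R :=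
  ∑ s : ι ≃ κ, ∏ k : ι, (A⁻¹).val (τ₂ (s k)) (τ₁ k)

/-- The formal Gaussian integral of the monomial `ū^α₁ u^α₂` with covariance `A⁻¹`. The list of
indices attached to `α` is the first projection of `Σ i, Fin (α i)`, in which every `i` occurs
exactly `α i` times; any other list with these multiplicities gives the same value
(`wickSum_eq_of_multiplicity`). -/
noncomputable def gaussianMonomial (A : Matrix.GeneralLinearGroup (Fin n) R)
    (α₁ α₂ : Fin n →₀ ℕ) : R :=
  ((Matrix.GeneralLinearGroup.det A)⁻¹ : Rˣ).val *
    wickSum A (Sigma.fst : (Σ i, Fin (α₁ i)) → Fin n) (Sigma.fst : (Σ i, Fin (α₂ i)) → Fin n)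

theorem wickSum_comp (A : Matrix.GeneralLinearGroup (Fin n) R)
    {ι κ ι' κ' : Type*} [Fintype ι] [Fintype κ] [DecidableEq ι] [DecidableEq κ]
    [Fintype ι'] [Fintype κ'] [DecidableEq ι'] [DecidableEq κ']
    (τ₁ : ι → Fin n) (τ₂ : κ → Fin n) (e₁ : ι' ≃ ι) (e₂ : κ' ≃ κ) :
    wickSum A (τ₁ ∘ e₁) (τ₂ ∘ e₂) = wickSum A τ₁ τ₂ := by
  unfold wickSum
  refine Fintype.sum_equiv (Equiv.equivCongr e₁ e₂) _ _ fun s => ?_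
  refine Fintype.prod_equiv e₁ _ _ fun k => ?_
  simp [Equiv.equivCongr]

theorem wickSum_eq_of_multiplicity (A : Matrix.GeneralLinearGroup (Fin n) R)
    (α₁ α₂ : Fin n →₀ ℕ) {k₁ k₂ : ℕ} (τ₁ : Fin k₁ → Fin n) (τ₂ : Fin k₂ → Fin n)
    (h₁ : ∀ i, Fintype.card {k // τ₁ k = i} = α₁ i)
    (h₂ : ∀ i, Fintype.card {k // τ₂ k = i} = α₂ i) :
    ((Matrix.GeneralLinearGroup.det A)⁻¹ : Rˣ).val * wickSum A τ₁ τ₂ =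
      gaussianMonomial A α₁ α₂ := by
  have key : ∀ {k : ℕ} (τ : Fin k → Fin n) (α : Fin n →₀ ℕ),
      (∀ i, Fintype.card {k // τ k = i} = α i) →
      ∃ e : Fin k ≃ (Σ i, Fin (α i)), τ = Sigma.fst ∘ e := by
    intro k τ α h
    refine ⟨(Equiv.sigmaFiberEquiv τ).symm.trans
      (Equiv.sigmaCongrRight fun i => Fintype.equivFinOfCardEq (h i)), ?_⟩
    funext j
    simp [Equiv.sigmaFiberEquiv]
  obtain ⟨e₁, he₁⟩ := key τ₁ α₁ h₁
  obtain ⟨e₂, he₂⟩ := key τ₂ α₂ h₂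
  rw [gaussianMonomial, he₁, he₂, wickSum_comp]

/-- The family of all terms `c_{α₁,α₂,α₃} X^α₃ ∫ e^{-ūAu} ū^α₁ u^α₂` of the formal Gaussian
integral of `U = ∑ c_{α₁,α₂,α₃} ū^α₁ u^α₂ X^α₃`. -/
noncomputable def gaussianTerm (A : Matrix.GeneralLinearGroup (Fin n) R)
    (U : MvPowerSeries (Var n) R)
    (α : (Fin n →₀ ℕ) × (Fin n →₀ ℕ) × (Fin n →₀ ℕ)) : MvPowerSeries (Fin n) R :=
  MvPowerSeries.monomial α.2.2
    (MvPowerSeries.coeff (triple α.1 α.2.1 α.2.2) U * gaussianMonomial A α.1 α.2.1)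

/-- The formal Gaussian integral of `U` is well defined in `R[[X]]`. -/
def GaussianIntegrable (A : Matrix.GeneralLinearGroup (Fin n) R)
    (U : MvPowerSeries (Var n) R) : Prop :=
  FormallySummable (gaussianTerm A U)

/-- The formal Gaussian integral `∫ dū du e^{-ūAu} U` in `R[[X]]`; meaningful when
`GaussianIntegrable A U`. -/
noncomputable def gaussianIntegral (A : Matrix.GeneralLinearGroup (Fin n) R)
    (U : MvPowerSeries (Var n) R) : MvPowerSeries (Fin n) R :=
  formalSum (gaussianTerm A U)

end Gaussian

section Series

variable {R : Type*} [CommRing R] {n : ℕ}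

/-- `H(u)` as an element of `R[[ū, u, X]]`. -/
noncomputable def inU (H : MvPowerSeries (Fin n) R) : MvPowerSeries (Var n) R :=
  MvPowerSeries.subst (fun j => (MvPowerSeries.X (Var.u j) : MvPowerSeries (Var n) R)) H

/-- `e^{ūXG(u)}` in `R[[ū, u, X]]`, where `ūXG(u) = ∑ i, ū_i X_i G_i(u)`. -/
noncomputable def expInteraction [Algebra ℚ R] (G : Fin n → MvPowerSeries (Fin n) R) :
    MvPowerSeries (Var n) R :=
  PowerSeries.subst
    (∑ i, MvPowerSeries.X (Var.ubar i) * MvPowerSeries.X (Var.x i) * inU (G i) :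
      MvPowerSeries (Var n) R)
    (PowerSeries.exp R)

/-- `F` has no constant terms and satisfies `F_i = X_i G_i(F)` for all `i`. -/
def IsImplicitSolution (G F : Fin n → MvPowerSeries (Fin n) R) : Prop :=
  (∀ i, MvPowerSeries.constantCoeff (F i) = 0) ∧
    ∀ i, F i = MvPowerSeries.X i * MvPowerSeries.subst F (G i)

/-- The matrix `X∂G(F)` with entries `X_i (∂_j G_i)(F)`. -/
noncomputable def xJacobian (G F : Fin n → MvPowerSeries (Fin n) R) :
    Matrix (Fin n) (Fin n) (MvPowerSeries (Fin n) R) :=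
  Matrix.of fun i j => MvPowerSeries.X i * MvPowerSeries.subst F (MvPowerSeries.pderiv R j (G i))

/-- `(∂/∂u)^α H` evaluated at `u = 0`. -/
noncomputable def derivAtZero (α : Fin n →₀ ℕ) (H : MvPowerSeries (Fin n) R) : R :=
  MvPowerSeries.constantCoeff
    ((List.finRange n).foldr (fun i K => (MvPowerSeries.pderiv R i)^[α i] K) H)

end Series

end LagrangeGood

open LagrangeGood

namespace LagrangeGood

/-! ### The Lagrange series and the implicit system -/

section LagrangeSeries

open MvPowerSeries

variable {R : Type*} [CommRing R] {n : ℕ}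

/-! Everything rests on the linear map L = `lagrangeSeries G`, with L(H) = ∑ X^α [u^α](H G^α). With
identity covariance, Wick's formula pairs ū^α only with u^α and yields α!, which cancels the 1/α! of
the exponential: the integral of Ω e^{ūXG} is L(Ω), and so is the sum of derivatives at 0. The map
satisfies L(u_i H) = X_i L(G_i H). By induction on degree, such a recursion together with the value
at 1 determines a linear map (`eq_zero_of_map_X_mul`). Hence H ↦ L(H)/L(1) is multiplicative, F_i =
L(u_i)/L(1) solves the system, and L(H) = H(F) L(1) for every solution F, which gives uniqueness. It
remains to show L(1) det(I - X∂G(F)) = 1. At X^α, L absorbs the substitution F, which leaves the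
coefficient of u^α in the determinant with entries δ_ij G_i^{α_i} - u_j G_i^{α_i-1} ∂_j G_i.
Splitting α = ∑ γ_i over the rows produces the factors det(δ_ij - γ_ij/α_i), which vanish for α ≠ 0
because the rows weighted by α_i sum to zero. -/

theorem coeff_X_mul (i : Fin n) (H : MvPowerSeries (Fin n) R) (d : Fin n →₀ ℕ) :
    coeff d (X i * H) = if d i = 0 then 0 else coeff (d - Finsupp.single i 1) H := by
  rw [X_def, coeff_monomial_mul, one_mul]
  simp only [Finsupp.single_le_iff, Nat.one_le_iff_ne_zero, ite_not]

theorem mpow_add {S : Type*} [CommMonoid S] (F : Fin n → S) (α β : Fin n →₀ ℕ) :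
    mpow F (α + β) = mpow F α * mpow F β := by
  simp [mpow, pow_add, Finset.prod_mul_distrib]

theorem mpow_single {S : Type*} [CommMonoid S] (F : Fin n → S) (i : Fin n) :
    mpow F (Finsupp.single i 1) = F i := by
  rw [mpow, Finset.prod_eq_single i] <;> simp +contextual [eq_comm]

theorem map_mpow {S T : Type*} [CommSemiring S] [CommSemiring T] (φ : S →+* T) (F : Fin n → S)
    (α : Fin n →₀ ℕ) : φ (mpow F α) = mpow (fun i => φ (F i)) α := by
  simp [mpow, map_prod, map_pow]

theorem mpow_X (α : Fin n →₀ ℕ) :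
    mpow (X : Fin n → MvPowerSeries (Fin n) R) α = monomial α 1 := by
  rw [monomial_one_eq, Finsupp.prod_fintype _ _ (by simp), mpow]

/-- The map `H ↦ ∑_α X^α [u^α] (H(u) G(u)^α)`. -/
noncomputable def lagrangeSeries (G : Fin n → MvPowerSeries (Fin n) R) :
    MvPowerSeries (Fin n) R →ₗ[R] MvPowerSeries (Fin n) R where
  toFun H := fun α => coeff α (H * mpow G α)
  map_add' H K := by
    ext α
    change coeff α ((H + K) * mpow G α) = coeff α (H * mpow G α) + coeff α (K * mpow G α)
    rw [add_mul, map_add]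
  map_smul' r H := by
    ext α
    change coeff α ((r • H) * mpow G α) = r * coeff α (H * mpow G α)
    rw [smul_mul_assoc, coeff_smul]

theorem coeff_lagrangeSeries (G : Fin n → MvPowerSeries (Fin n) R) (H : MvPowerSeries (Fin n) R)
    (α : Fin n →₀ ℕ) : coeff α (lagrangeSeries G H) = coeff α (H * mpow G α) := rfl

/-- Lowering the exponent from α to α - e_i releases one factor G_i from G^α. -/
theorem lagrangeSeries_X_mul (G : Fin n → MvPowerSeries (Fin n) R) (i : Fin n)
    (H : MvPowerSeries (Fin n) R) :
    lagrangeSeries G (X i * H) = X i * lagrangeSeries G (G i * H) := by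
  ext α
  rw [coeff_lagrangeSeries, mul_assoc, coeff_X_mul, coeff_X_mul]
  split_ifs with h
  · rfl
  · rw [coeff_lagrangeSeries]
    have : mpow G α = mpow G (α - Finsupp.single i 1) * G i := by
      rw [← mpow_single G i, ← mpow_add, tsub_add_cancel_of_le]
      rw [Finsupp.single_le_iff]; omega
    rw [this]
    congr 1; ring

theorem constantCoeff_lagrangeSeries_one (G : Fin n → MvPowerSeries (Fin n) R) :
    constantCoeff (lagrangeSeries G 1) = 1 := by
  rw [← coeff_zero_eq_constantCoeff_apply, coeff_lagrangeSeries]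
  simp [mpow]

theorem isUnit_lagrangeSeries_one (G : Fin n → MvPowerSeries (Fin n) R) :
    IsUnit (lagrangeSeries G 1) := by
  rw [MvPowerSeries.isUnit_iff_constantCoeff, constantCoeff_lagrangeSeries_one]
  exact isUnit_one

theorem hasSubst_of_isImplicitSolution {G F : Fin n → MvPowerSeries (Fin n) R}
    (hF : IsImplicitSolution G F) : HasSubst F :=
  hasSubst_of_constantCoeff_zero hF.1

variable [Algebra ℚ R]

/-- Each nonconstant monomial u^d is shared among the variables with Euler weights d_i/|d|, which
sum to 1. -/
theorem exists_eq_C_add_sum_X_mul (H : MvPowerSeries (Fin n) R) :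
    ∃ K : Fin n → MvPowerSeries (Fin n) R, H = C (constantCoeff H) + ∑ i, X i * K i := by
  let K : Fin n → MvPowerSeries (Fin n) R := fun i d =>
    algebraMap ℚ R ((d i + 1) / (d.degree + 1)) * coeff (d + Finsupp.single i 1) H
  refine ⟨K, ?_⟩
  ext d
  have key : ∀ i, coeff d (X i * K i) =
      algebraMap ℚ R (d i / d.degree) * coeff d H := by
    intro i
    rw [coeff_X_mul]
    split_ifs with h
    · simp [h]
    · have hle : Finsupp.single i 1 ≤ d := by rw [Finsupp.single_le_iff]; omega
      obtain ⟨e, rfl⟩ := exists_add_of_le hle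
      rw [add_tsub_cancel_left, map_add, Finsupp.degree_single]
      change algebraMap ℚ R _ * coeff (e + _) H = _
      rw [add_comm e]
      congr 2
      simp [add_comm]
  rw [map_add, map_sum, Finset.sum_congr rfl fun i _ => key i, ← Finset.sum_mul, ← map_sum,
    ← Finset.sum_div, ← Nat.cast_sum, ← Finsupp.degree_eq_sum, coeff_C]
  split_ifs with h
  · simp [h]
  · have : (d.degree : ℚ) ≠ 0 := by simpa [Finsupp.degree_eq_zero_iff] using h
    rw [div_self this]; simp

/-- A linear map that vanishes at `1` and sends multiples of `X_i` to `X_i` times multiples of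
its values vanishes identically. -/
theorem eq_zero_of_map_X_mul (D : MvPowerSeries (Fin n) R →ₗ[R] MvPowerSeries (Fin n) R)
    (h1 : D 1 = 0) (hD : ∀ i H, ∃ c K, D (X i * H) = X i * (c * D K)) : D = 0 := by
  -- The factor X_i gains one degree while H is replaced by another series, so the induction must
  -- cover all H at once.
  have key : ∀ (m : ℕ) (H) (d : Fin n →₀ ℕ), d.degree < m → coeff d (D H) = 0 := by
    intro m
    induction m with
    | zero => intro H d hd; omega
    | succ m ih =>
      intro H d hd
      obtain ⟨K, hK⟩ := exists_eq_C_add_sum_X_mul H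
      have hC : D (C (constantCoeff H)) = 0 := by
        rw [← mul_one (C (constantCoeff H)), ← smul_eq_C_mul, map_smul, h1, smul_zero]
      rw [hK, map_add, hC, zero_add, map_sum, map_sum]
      refine Finset.sum_eq_zero fun i _ => ?_
      obtain ⟨c, K', h⟩ := hD i (K i)
      rw [h, coeff_X_mul]
      split_ifs with hi
      · rfl
      · rw [coeff_mul]
        refine Finset.sum_eq_zero fun p hp => ?_
        rw [ih, mul_zero]
        rw [Finset.HasAntidiagonal.mem_antidiagonal] at hp
        have hle : Finsupp.single i 1 ≤ d := by rw [Finsupp.single_le_iff]; omega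
        have h2 : p.1 + p.2 + Finsupp.single i 1 = d := by rw [hp, tsub_add_cancel_of_le hle]
        have h3 := congrArg Finsupp.degree h2
        rw [map_add, map_add, Finsupp.degree_single] at h3
        omega
  ext H d
  exact key _ H d (Nat.lt_succ_self _)

/-- For fixed K, both sides obey the same recursion in H and agree at H = 1. -/
theorem lagrangeSeries_mul (G : Fin n → MvPowerSeries (Fin n) R) (H K : MvPowerSeries (Fin n) R) :
    lagrangeSeries G (H * K) * lagrangeSeries G 1 = lagrangeSeries G H * lagrangeSeries G K := by
  have h := eq_zero_of_map_X_mul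
    ((LinearMap.mulRight R (lagrangeSeries G 1)) ∘ₗ lagrangeSeries G ∘ₗ LinearMap.mulRight R K -
      (LinearMap.mulRight R (lagrangeSeries G K)) ∘ₗ lagrangeSeries G)
    (by simp [mul_comm]) (fun i H => ⟨1, G i * H, by
      simp [mul_assoc, lagrangeSeries_X_mul, mul_sub]⟩)
  exact sub_eq_zero.1 (LinearMap.congr_fun h H)

/-- The equation F_i = X_i G_i(F) says that H ↦ H(F) L(1) obeys the recursion of L. -/
theorem lagrangeSeries_eq_subst_mul {G F : Fin n → MvPowerSeries (Fin n) R}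
    (hF : IsImplicitSolution G F) (H : MvPowerSeries (Fin n) R) :
    lagrangeSeries G H = subst F H * lagrangeSeries G 1 := by
  have hs := hasSubst_of_isImplicitSolution hF
  have h := eq_zero_of_map_X_mul
    (lagrangeSeries G - (LinearMap.mulRight R (lagrangeSeries G 1)) ∘ₗ
      (substAlgHom (R := R) hs).toLinearMap)
    (by simp [-substAlgHom_apply, -coe_substAlgHom]) (fun i H => ⟨1, G i * H, by
      have : substAlgHom (R := R) hs (X i) = X i * substAlgHom (R := R) hs (G i) := by
        rw [substAlgHom_X, coe_substAlgHom]; exact hF.2 i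
      simp [-substAlgHom_apply, -coe_substAlgHom, lagrangeSeries_X_mul, mul_sub, this, mul_assoc]⟩)
  have h2 := sub_eq_zero.1 (LinearMap.congr_fun h H)
  simpa using h2

theorem existsUnique_isImplicitSolution (G : Fin n → MvPowerSeries (Fin n) R) :
    ∃! F : Fin n → MvPowerSeries (Fin n) R, IsImplicitSolution G F := by
  -- With v = 1/L(1), the solution will be F_i = L(u_i) v.
  obtain ⟨v, hv⟩ := (isUnit_lagrangeSeries_one G).exists_right_inv
  have hmul : ∀ H K, lagrangeSeries G (H * K) * v =
      (lagrangeSeries G H * v) * (lagrangeSeries G K * v) := fun H K => by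
    linear_combination (v ^ 2) * lagrangeSeries_mul G H K - lagrangeSeries G (H * K) * v * hv
  have h0 : ∀ i, constantCoeff (lagrangeSeries G (X i) * v) = 0 := fun i => by
    have := lagrangeSeries_X_mul G i 1
    rw [mul_one] at this
    simp [this]
  have hs : HasSubst fun i => lagrangeSeries G (X i) * v := hasSubst_of_constantCoeff_zero h0
  have hX : ∀ i, lagrangeSeries G (X i) * v = X i * (lagrangeSeries G (G i) * v) := fun i => by
    have := lagrangeSeries_X_mul G i 1
    rw [mul_one, mul_one] at this
    rw [this, mul_assoc]
  -- The multiplicative map H ↦ L(H) v is substitution of its values at the variables, which turns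
  -- `hX` into the implicit system.
  have hsub : ∀ H, lagrangeSeries G H * v = subst (fun i => lagrangeSeries G (X i) * v) H := by
    intro H
    have h := eq_zero_of_map_X_mul
      ((LinearMap.mulRight R v) ∘ₗ lagrangeSeries G - (substAlgHom (R := R) hs).toLinearMap)
      (by simp [-substAlgHom_apply, -coe_substAlgHom, hv]) (fun i H => ⟨lagrangeSeries G (G i) * v, H, by
        simp only [LinearMap.sub_apply, LinearMap.comp_apply, LinearMap.mulRight_apply,
          AlgHom.toLinearMap_apply, map_mul, substAlgHom_X, hmul, hX i]
        ring⟩)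
    have h2 := sub_eq_zero.1 (LinearMap.congr_fun h H)
    simpa using h2
  refine ⟨_, ⟨h0, fun i => ?_⟩, fun F hF => funext fun i => ?_⟩
  · simp only [← hsub]
    exact hX i
  · have := lagrangeSeries_eq_subst_mul hF (X i)
    rw [subst_X (hasSubst_of_isImplicitSolution hF)] at this
    rw [this, mul_assoc, hv, mul_one]

end LagrangeSeries

/-! ### The Jacobian determinant -/

section Determinant

open MvPowerSeries

variable {R : Type*} [CommRing R] {n : ℕ}

theorem coeff_X_mul_pderiv (j : Fin n) (H : MvPowerSeries (Fin n) R) (γ : Fin n →₀ ℕ) :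
    coeff γ (X j * pderiv R j H) = γ j * coeff γ H := by
  rw [coeff_X_mul]
  split_ifs with h
  · simp [h]
  · have hle : Finsupp.single j 1 ≤ γ := by rw [Finsupp.single_le_iff]; omega
    obtain ⟨e, rfl⟩ := exists_add_of_le hle
    rw [add_tsub_cancel_left, coeff_pderiv, add_comm e, mul_comm]
    simp [add_comm]

/-- The contribution of `X_i ∂_j G_i` to the coefficients of `X_i^a` once all powers of `G_i` have
been collected. -/
noncomputable def rowDeriv (H : MvPowerSeries (Fin n) R) (a : ℕ) (j : Fin n) :
    MvPowerSeries (Fin n) R :=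
  if a = 0 then 0 else X j * (H ^ (a - 1) * pderiv R j H)

/-- The Euler operator u_j ∂_j multiplies the coefficient of u^γ in H^a by γ_j, and u_j ∂_j H^a is a
times the row entry. For a = 0 both sides vanish, division by zero giving 0. -/
theorem coeff_rowDeriv [Algebra ℚ R] (H : MvPowerSeries (Fin n) R) (a : ℕ) (j : Fin n)
    (γ : Fin n →₀ ℕ) :
    coeff γ (rowDeriv H a j) = algebraMap ℚ R (γ j / a) * coeff γ (H ^ a) := by
  rw [rowDeriv]
  split_ifs with h
  · simp [h]
  · have ha : (a : ℚ) ≠ 0 := Nat.cast_ne_zero.2 h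
    have key : (a : R) * coeff γ (X j * (H ^ (a - 1) * pderiv R j H)) =
        γ j * coeff γ (H ^ a) := by
      rw [← coeff_X_mul_pderiv, pderiv_pow, ← coeff_C_mul]
      congr 1
      rw [map_natCast]
      ring
    have hinv : algebraMap ℚ R (a : ℚ)⁻¹ * (a : R) = 1 := by
      rw [← map_natCast (algebraMap ℚ R) a, ← map_mul, inv_mul_cancel₀ ha, map_one]
    rw [div_eq_inv_mul, map_mul (algebraMap ℚ R), map_natCast (algebraMap ℚ R), mul_assoc, ← key]
    rw [← mul_assoc (algebraMap ℚ R _), hinv, one_mul]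

/-- The nonzero vector α lies in the left kernel: column j gives α_j - ∑_i γ_ij = 0. Since γ_ij/0 =
0, the rows with α_i = 0 need γ_i = 0. -/
theorem det_one_sub_div_eq_zero {α : Fin n →₀ ℕ} (hα : α ≠ 0) (γ : Fin n → Fin n →₀ ℕ)
    (hγ : ∑ i, γ i = α) (h0 : ∀ i, α i = 0 → γ i = 0) :
    (Matrix.of fun i j => (if i = j then 1 else 0) - (γ i j : ℚ) / α i).det = 0 := by
  rw [← Matrix.exists_vecMul_eq_zero_iff]
  refine ⟨fun i => α i, fun h => hα ?_, ?_⟩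
  · ext i
    simpa using congrFun h i
  · ext j
    have h1 : ∀ i, (α i : ℚ) * ((γ i j : ℚ) / α i) = γ i j := by
      intro i
      by_cases hi : α i = 0
      · simp [h0 i hi]
      · field_simp
    simp only [Matrix.vecMul, dotProduct, Matrix.of_apply, mul_sub, h1, Finset.sum_sub_distrib,
      mul_ite, mul_one, mul_zero, Finset.sum_ite_eq', Finset.mem_univ, if_true, Pi.zero_apply]
    rw [← hγ, Finsupp.finsetSum_apply]
    simp

theorem coeff_det_rows [Algebra ℚ R] (G : Fin n → MvPowerSeries (Fin n) R) (α : Fin n →₀ ℕ) :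
    coeff α (Matrix.of fun i j =>
      (if i = j then 1 else 0) * G i ^ α i - rowDeriv (G i) (α i) j).det =
      if α = 0 then 1 else 0 := by
  classical
  split_ifs with hα
  · subst hα
    have : (Matrix.of fun i j : Fin n => (if i = j then 1 else 0) * G i ^ (0 : Fin n →₀ ℕ) i -
        rowDeriv (G i) ((0 : Fin n →₀ ℕ) i) j) = 1 := by
      ext i j : 2
      simp [rowDeriv, Matrix.one_apply]
    rw [this, Matrix.det_one, coeff_zero_one]
  have hrow : ∀ (i j : Fin n) (γ : Fin n →₀ ℕ),
      coeff γ ((if i = j then 1 else 0) * G i ^ α i - rowDeriv (G i) (α i) j) =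
      algebraMap ℚ R ((if i = j then 1 else 0) - (γ j : ℚ) / α i) * coeff γ (G i ^ α i) := by
    intro i j γ
    rw [map_sub, coeff_rowDeriv, map_sub, sub_mul]
    split_ifs <;> simp
  -- After transposing, the i-th factor comes from row i, which involves only G_i.
  rw [← Matrix.det_transpose, Matrix.det_apply', map_sum]
  have hterm : ∀ s : Equiv.Perm (Fin n),
      coeff α (((Equiv.Perm.sign s : ℤ) : MvPowerSeries (Fin n) R) *
      ∏ i, (Matrix.of fun i j =>
        (if i = j then 1 else 0) * G i ^ α i - rowDeriv (G i) (α i) j).transpose (s i) i) =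
      ∑ l ∈ Finset.finsuppAntidiag Finset.univ α,
        algebraMap ℚ R (((Equiv.Perm.sign s : ℤ) : ℚ) * ∏ i, (Matrix.of fun i j =>
          (if i = j then 1 else 0) - (l i j : ℚ) / α i).transpose (s i) i) *
        ∏ i, coeff (l i) (G i ^ α i) := by
    intro s
    rw [← map_intCast (C (σ := Fin n) (R := R)), coeff_C_mul, coeff_prod, Finset.mul_sum]
    refine Finset.sum_congr rfl fun l _ => ?_
    simp only [Matrix.transpose_apply, Matrix.of_apply, hrow, Finset.prod_mul_distrib, map_mul,
      map_prod, map_intCast, mul_assoc]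
  rw [Finset.sum_congr rfl fun s _ => hterm s, Finset.sum_comm]
  refine Finset.sum_eq_zero fun l hl => ?_
  rw [← Finset.sum_mul, ← map_sum, ← Matrix.det_apply', Matrix.det_transpose]
  by_cases h : ∀ i, α i = 0 → l i = 0
  · rw [det_one_sub_div_eq_zero hα (fun i => l i) (Finset.mem_finsuppAntidiag.1 hl).1 h, map_zero,
      zero_mul]
  -- Here G_i^0 = 1 has no coefficient at l_i ≠ 0.
  · push Not at h
    obtain ⟨i, hi, hli⟩ := h
    rw [Finset.prod_eq_zero (Finset.mem_univ i), mul_zero]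
    rw [hi, pow_zero, coeff_one, if_neg hli]

/-- At a fixed α, the factor ∏ X_i shifts the index, so the power of G inside L becomes an ordinary
factor with exponents lowered by one on t. -/
theorem coeff_prod_X_mul_lagrangeSeries (G : Fin n → MvPowerSeries (Fin n) R)
    (P : MvPowerSeries (Fin n) R) (t : Finset (Fin n)) (α : Fin n →₀ ℕ) (ht : ∀ i ∈ t, α i ≠ 0) :
    coeff α ((∏ i ∈ t, X i) * lagrangeSeries G P) =
      coeff α ((∏ i ∈ t, X i) * (P * ((∏ i ∈ t, G i ^ (α i - 1)) * ∏ i ∈ tᶜ, G i ^ α i))) := by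
  classical
  let ε : Fin n →₀ ℕ := Finsupp.equivFunOnFinite.symm fun i => if i ∈ t then 1 else 0
  have hε : ∏ i ∈ t, (X i : MvPowerSeries (Fin n) R) = monomial ε 1 := by
    rw [← mpow_X, mpow]
    simp [ε, Finset.prod_ite_mem, pow_ite]
  have hle : ε ≤ α := fun i => by
    by_cases hi : i ∈ t
    · simpa [ε, hi, Nat.one_le_iff_ne_zero] using ht i hi
    · simp [ε, hi]
  have hG : (∏ i ∈ t, G i ^ (α i - 1)) * ∏ i ∈ tᶜ, G i ^ α i = mpow G (α - ε) := by
    rw [mpow, ← Finset.prod_mul_prod_compl t]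
    congr 1 <;> refine Finset.prod_congr rfl fun i hi => ?_
    · simp [ε, hi]
    · simp [ε, Finset.mem_compl.1 hi]
  rw [hε, hG, coeff_monomial_mul, coeff_monomial_mul, coeff_lagrangeSeries]

variable [Algebra ℚ R]

theorem coeff_lagrangeSeries_one_mul_prod {G F : Fin n → MvPowerSeries (Fin n) R}
    (hF : IsImplicitSolution G F) (s : Equiv.Perm (Fin n)) (α : Fin n →₀ ℕ) :
    coeff α (lagrangeSeries G 1 *
      ∏ i, ((if i = s i then 1 else 0) - X i * subst F (pderiv R (s i) (G i)))) =
    coeff α (∏ i, ((if i = s i then 1 else 0) * G i ^ α i - rowDeriv (G i) (α i) (s i))) := by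
  classical
  have hs := hasSubst_of_isImplicitSolution hF
  -- Both products are expanded over the set t of rows contributing their derivative term, and
  -- compared for each t.
  rw [Finset.prod_sub, Finset.prod_sub, Finset.mul_sum, map_sum, map_sum]
  refine Finset.sum_congr rfl fun t _ => ?_
  rw [← Finset.compl_eq_univ_sdiff, Finset.prod_mul_distrib, Finset.prod_mul_distrib]
  by_cases hfix : ∀ i ∈ tᶜ, i = s i
  · have h1 : ∏ i ∈ tᶜ, (if i = s i then (1 : MvPowerSeries (Fin n) R) else 0) = 1 :=
      Finset.prod_eq_one fun i hi => if_pos (hfix i hi)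
    have h2 : (∏ i ∈ t, subst F (pderiv R (s i) (G i))) * lagrangeSeries G 1 =
        lagrangeSeries G (∏ i ∈ t, pderiv R (s i) (G i)) := by
      rw [lagrangeSeries_eq_subst_mul hF (∏ i ∈ t, pderiv R (s i) (G i)), ← coe_substAlgHom hs,
        map_prod]
    have h3 : lagrangeSeries G 1 * ((-1) ^ t.card * 1 *
        ((∏ i ∈ t, X i) * ∏ i ∈ t, subst F (pderiv R (s i) (G i)))) =
        C ((-1) ^ t.card) * ((∏ i ∈ t, X i) *
          lagrangeSeries G (∏ i ∈ t, pderiv R (s i) (G i))) := by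
      rw [← h2, map_pow, map_neg, map_one C]; ring
    rw [h1, h3, coeff_C_mul]
    by_cases ht : ∀ i ∈ t, α i ≠ 0
    · rw [coeff_prod_X_mul_lagrangeSeries G _ t α ht, ← coeff_C_mul]
      congr 1
      have h4 : ∏ i ∈ t, rowDeriv (G i) (α i) (s i) = (∏ i ∈ t, X i) *
          ((∏ i ∈ t, G i ^ (α i - 1)) * ∏ i ∈ t, pderiv R (s i) (G i)) := by
        -- The Jacobian carries X_i and the row entry X_{s(i)}. As s fixes the complement of t, it
        -- permutes t, and the products agree.
        have h5 : ∏ i ∈ t, (X (s i) : MvPowerSeries (Fin n) R) = ∏ i ∈ t, X i := by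
          refine Finset.prod_equiv s (fun i => ?_) fun i _ => rfl
          by_cases hi : i ∈ t
          · by_contra hcon
            have hsi : s i ∈ tᶜ := Finset.mem_compl.2 fun h => hcon (by simp [hi, h])
            have := s.injective (hfix _ hsi)
            exact Finset.mem_compl.1 hsi (this ▸ hi)
          · rw [← hfix i (Finset.mem_compl.2 hi)]
        rw [← h5, ← Finset.prod_mul_distrib, ← Finset.prod_mul_distrib]
        exact Finset.prod_congr rfl fun i hi => if_neg (ht i hi)
      rw [h4, map_pow, map_neg, map_one]; ring
    -- If α_i = 0 for some i in t, X_i kills the left side and the zero value of `rowDeriv` the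
    -- right.
    · push Not at ht
      obtain ⟨i, hi, hαi⟩ := ht
      rw [← Finset.mul_prod_erase t X hi, mul_assoc, coeff_X_mul, if_pos hαi,
        Finset.prod_eq_zero (s := t) (i := i) (f := fun i => rowDeriv (G i) (α i) (s i)) hi
          (if_pos hαi)]
      simp
  · push Not at hfix
    obtain ⟨i, hi, hne⟩ := hfix
    rw [Finset.prod_eq_zero (s := tᶜ) (i := i)
      (f := fun i => if i = s i then (1 : MvPowerSeries (Fin n) R) else 0) hi (if_neg hne)]
    simp

theorem lagrangeSeries_one_mul_det {G F : Fin n → MvPowerSeries (Fin n) R}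
    (hF : IsImplicitSolution G F) :
    lagrangeSeries G 1 * (1 - xJacobian G F).det = 1 := by
  classical
  ext α
  rw [coeff_one, ← coeff_det_rows G α, ← Matrix.det_transpose, Matrix.det_apply', Finset.mul_sum,
    map_sum, ← Matrix.det_transpose, Matrix.det_apply', map_sum]
  refine Finset.sum_congr rfl fun s _ => ?_
  rw [mul_left_comm, ← map_intCast (C (σ := Fin n) (R := R)), coeff_C_mul, coeff_C_mul]
  congr 1
  refine Eq.trans ?_ (coeff_lagrangeSeries_one_mul_prod hF s α)
  simp only [Matrix.transpose_apply, Matrix.sub_apply, Matrix.one_apply, xJacobian,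
    Matrix.of_apply]

theorem isUnit_det_one_sub_xJacobian {G F : Fin n → MvPowerSeries (Fin n) R}
    (hF : IsImplicitSolution G F) : IsUnit (1 - xJacobian G F).det :=
  IsUnit.of_mul_eq_one_right _ (lagrangeSeries_one_mul_det hF)

theorem lagrangeSeries_eq_subst_mul_inverse_det {G F : Fin n → MvPowerSeries (Fin n) R}
    (hF : IsImplicitSolution G F) (H : MvPowerSeries (Fin n) R) :
    lagrangeSeries G H = subst F H * Ring.inverse (1 - xJacobian G F).det := by
  have h := isUnit_det_one_sub_xJacobian hF
  rw [lagrangeSeries_eq_subst_mul hF]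
  linear_combination (-subst F H * lagrangeSeries G 1) * Ring.mul_inverse_cancel _ h +
    subst F H * Ring.inverse (1 - xJacobian G F).det * lagrangeSeries_one_mul_det hF

end Determinant

/-! ### Derivatives at zero as coefficients -/

section DerivAtZero

open MvPowerSeries

variable {R : Type*} [CommRing R] {n : ℕ}

theorem coeff_iterate_pderiv (i : Fin n) (k : ℕ) (H : MvPowerSeries (Fin n) R)
    (d : Fin n →₀ ℕ) :
    coeff d ((pderiv R i)^[k] H) =
      (d i + 1).ascFactorial k * coeff (d + Finsupp.single i k) H := by
  induction k generalizing d with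
  | zero => simp
  | succ k ih =>
    rw [Function.iterate_succ_apply', coeff_pderiv, ih, add_assoc d, ← Finsupp.single_add,
      add_comm 1 k, Nat.ascFactorial_succ, ← Nat.succ_ascFactorial]
    simp only [Finsupp.add_apply, Finsupp.single_eq_same, Nat.cast_mul, Nat.succ_eq_add_one]
    push_cast
    ring

/-- Since d vanishes on l, each rising factorial starts at 1 and becomes a factorial. -/
theorem coeff_foldr_pderiv (α : Fin n →₀ ℕ) (H : MvPowerSeries (Fin n) R) (l : List (Fin n))
    (hl : l.Nodup) (d : Fin n →₀ ℕ) (hd : ∀ i ∈ l, d i = 0) :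
    coeff d (l.foldr (fun i K => (pderiv R i)^[α i] K) H) =
      ((l.map fun i => (α i).factorial).prod : ℕ) *
        coeff (d + (l.map fun i => Finsupp.single i (α i)).sum) H := by
  induction l generalizing d with
  | nil => simp
  | cons i l ih =>
    rw [List.nodup_cons] at hl
    rw [List.foldr_cons, coeff_iterate_pderiv, ih hl.2, hd i (by simp), zero_add,
      Nat.one_ascFactorial, List.map_cons, List.prod_cons, List.map_cons, List.sum_cons,
      Nat.cast_mul, mul_assoc, add_assoc]
    intro j hj
    have hne : i ≠ j := fun h => hl.1 (h ▸ hj)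
    simp [hd j (List.mem_cons_of_mem _ hj), hne]

theorem derivAtZero_eq (α : Fin n →₀ ℕ) (H : MvPowerSeries (Fin n) R) :
    derivAtZero α H = mfactorial α * coeff α H := by
  rw [derivAtZero, ← coeff_zero_eq_constantCoeff_apply,
    coeff_foldr_pderiv α H _ (List.nodup_finRange n) 0 (by simp), ← Fin.prod_univ_def,
    ← Fin.sum_univ_def, Finsupp.univ_sum_single, zero_add, mfactorial]

end DerivAtZero

/-! ### Wick's formula with identity covariance -/

section Wick

variable {R : Type*} [CommRing R] {n : ℕ}

/-- Only label-preserving pairings contribute, each with 1. They force equal fibre sizes, and for α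
= β they form the stabilizer of the labelling, of order ∏ α_i!. -/
theorem gaussianMonomial_one (α β : Fin n →₀ ℕ) :
    gaussianMonomial (1 : Matrix.GeneralLinearGroup (Fin n) R) α β =
      if α = β then (mfactorial α : R) else 0 := by
  have hw : gaussianMonomial (1 : Matrix.GeneralLinearGroup (Fin n) R) α β =
      ∑ s : (Σ i, Fin (α i)) ≃ (Σ i, Fin (β i)), if ∀ k, (s k).1 = k.1 then (1 : R) else 0 := by
    simp [gaussianMonomial, wickSum, Matrix.one_apply, Finset.prod_boole]
  rw [hw]
  split_ifs with h
  · subst h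
    rw [Finset.sum_boole, ← Fintype.card_subtype]
    have hc := DomMulAct.stabilizer_card (f := (Sigma.fst : (Σ i, Fin (α i)) → Fin n))
    have hfib : ∀ i, Fintype.card {a : Σ i, Fin (α i) // a.1 = i} = α i := fun i => by
      rw [Fintype.card_congr (Equiv.sigmaSubtype i), Fintype.card_fin]
    simp only [hfib] at hc
    rw [mfactorial, ← hc]
    congr 1
    exact Fintype.card_congr (Equiv.subtypeEquivRight fun s => by simp [funext_iff])
  · refine Finset.sum_eq_zero fun s _ => if_neg fun hs => h ?_
    ext i
    have := Fintype.card_congr (s.subtypeEquiv (p := fun a => a.1 = i) (q := fun a => a.1 = i)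
      fun a => by rw [hs a])
    rwa [Fintype.card_congr (Equiv.sigmaSubtype i), Fintype.card_congr (Equiv.sigmaSubtype i),
      Fintype.card_fin, Fintype.card_fin] at this

theorem coeff_gaussianTerm (A : Matrix.GeneralLinearGroup (Fin n) R) (U : MvPowerSeries (Var n) R)
    (d a b c : Fin n →₀ ℕ) :
    MvPowerSeries.coeff d (gaussianTerm A U (a, b, c)) =
      if d = c then MvPowerSeries.coeff (triple a b c) U * gaussianMonomial A a b else 0 := by
  classical
  rw [gaussianTerm, MvPowerSeries.coeff_monomial]

/-- The X-exponent c determines the ū-exponent p(c), and Wick's formula forces the u-exponent to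
equal it, so each X^d receives at most one term. It serves with p = `id` for the exponential and p
constant for ū^α. -/
theorem gaussianIntegrable_of_forall_ne {U : MvPowerSeries (Var n) R}
    (p : (Fin n →₀ ℕ) → Fin n →₀ ℕ)
    (hU : ∀ a b c, a ≠ p c → MvPowerSeries.coeff (triple a b c) U = 0) :
    GaussianIntegrable 1 U ∧ ∀ d, MvPowerSeries.coeff d (gaussianIntegral 1 U) =
      MvPowerSeries.coeff (triple (p d) (p d) d) U * mfactorial (p d) := by
  have key : ∀ d x, x ≠ (p d, p d, d) →
      MvPowerSeries.coeff d (gaussianTerm (1 : Matrix.GeneralLinearGroup (Fin n) R) U x) = 0 := by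
    rintro d ⟨a, b, c⟩ hx
    rw [coeff_gaussianTerm, gaussianMonomial_one]
    by_cases hc : d = c
    · subst hc
      by_cases ha : a = p d
      · have hab : a ≠ b := by
          rintro rfl
          exact hx (by rw [← ha])
        rw [if_neg hab, mul_zero, ite_self]
      · rw [hU a b d ha, zero_mul, ite_self]
    · rw [if_neg hc]
  refine ⟨fun d => (Set.finite_singleton (p d, p d, d)).subset fun x hx => ?_, fun d => ?_⟩
  · by_contra hne
    exact hx (key d x hne)
  · change ∑ᶠ x, MvPowerSeries.coeff d (gaussianTerm 1 U x) = _
    rw [finsum_eq_single _ (p d, p d, d) (key d), coeff_gaussianTerm, if_pos rfl,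
      gaussianMonomial_one, if_pos rfl]

end Wick

/-! ### Coefficients of the interaction and the integrals -/

section Interaction

open MvPowerSeries

variable {R : Type*} [CommRing R] {n : ℕ}

theorem triple_inj {a b c a' b' c' : Fin n →₀ ℕ} :
    triple a b c = triple a' b' c' ↔ a = a' ∧ b = b' ∧ c = c' := by
  constructor
  · intro h
    refine ⟨?_, ?_, ?_⟩ <;> ext i
    · simpa [triple] using DFunLike.congr_fun h (Sum.inl i)
    · simpa [triple] using DFunLike.congr_fun h (Sum.inr (Sum.inl i))
    · simpa [triple] using DFunLike.congr_fun h (Sum.inr (Sum.inr i))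
  · rintro ⟨rfl, rfl, rfl⟩; rfl

theorem triple_le_triple {a b c a' b' c' : Fin n →₀ ℕ} :
    triple a b c ≤ triple a' b' c' ↔ a ≤ a' ∧ b ≤ b' ∧ c ≤ c' := by
  constructor
  · intro h
    refine ⟨fun i => ?_, fun i => ?_, fun i => ?_⟩
    · simpa [triple] using h (Sum.inl i)
    · simpa [triple] using h (Sum.inr (Sum.inl i))
    · simpa [triple] using h (Sum.inr (Sum.inr i))
  · rintro ⟨h₁, h₂, h₃⟩ (i | i | i)
    · simpa [triple] using h₁ i
    · simpa [triple] using h₂ i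
    · simpa [triple] using h₃ i

theorem triple_sub_triple (a b c a' b' c' : Fin n →₀ ℕ) :
    triple a b c - triple a' b' c' = triple (a - a') (b - b') (c - c') := by
  ext (i | i | i) <;> simp [triple]

theorem mpow_X_mul_mpow_X_mul_mpow_X (a b c : Fin n →₀ ℕ) :
    mpow (fun i => (X (Var.ubar i) : MvPowerSeries (Var n) R)) a *
      (mpow (fun i => X (Var.u i)) b * mpow (fun i => X (Var.x i)) c) =
      monomial (triple a b c) 1 := by
  rw [monomial_one_eq, Finsupp.prod_fintype _ _ (by simp)]
  simp [mpow, triple, Fintype.prod_sum_type, Var.ubar, Var.u, Var.x]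

theorem hasSubst_u : HasSubst fun j : Fin n => (X (Var.u j) : MvPowerSeries (Var n) R) :=
  hasSubst_of_constantCoeff_zero fun _ => constantCoeff_X _

theorem inU_mul (H K : MvPowerSeries (Fin n) R) : inU (H * K) = inU H * inU K :=
  subst_mul hasSubst_u H K

theorem mpow_inU (G : Fin n → MvPowerSeries (Fin n) R) (α : Fin n →₀ ℕ) :
    mpow (fun i => inU (G i)) α = inU (mpow G α) := by
  have h := map_mpow (substAlgHom (R := R) (hasSubst_u (R := R) (n := n))).toRingHom G α
  simpa [inU] using h.symm

theorem mpow_X_u (α : Fin n →₀ ℕ) :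
    mpow (fun i => (X (Var.u i) : MvPowerSeries (Var n) R)) α = inU (mpow X α) := by
  rw [← mpow_inU]
  simp only [inU, subst_X hasSubst_u]

theorem coeff_inU (H : MvPowerSeries (Fin n) R) (a b c : Fin n →₀ ℕ) :
    coeff (triple a b c) (inU H) = if a = 0 ∧ c = 0 then coeff b H else 0 := by
  classical
  have hmon : ∀ d : Fin n →₀ ℕ, (d.prod fun s e => (X (Var.u s) : MvPowerSeries (Var n) R) ^ e) =
      monomial (triple 0 d 0) 1 := fun d => by
    rw [← mpow_X_mul_mpow_X_mul_mpow_X, Finsupp.prod_fintype _ _ (by simp)]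
    simp [mpow]
  rw [inU, coeff_subst hasSubst_u]
  simp only [hmon, coeff_monomial, triple_inj, smul_eq_mul]
  rw [finsum_eq_single _ b fun d hd => by simp [hd.symm]]
  simp

theorem coeff_monomial_mul_inU (H : MvPowerSeries (Fin n) R) (κ μ a b c : Fin n →₀ ℕ) :
    coeff (triple a b c) (monomial (triple κ 0 μ) 1 * inU H) =
      if a = κ ∧ c = μ then coeff b H else 0 := by
  classical
  rw [coeff_monomial_mul, triple_sub_triple, coeff_inU, one_mul, ← ite_and]
  refine if_congr ?_ (by simp) rfl
  rw [triple_le_triple, tsub_eq_zero_iff_le, tsub_eq_zero_iff_le]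
  constructor
  · rintro ⟨⟨h₁, -, h₃⟩, h₄, h₅⟩
    exact ⟨le_antisymm h₄ h₁, le_antisymm h₅ h₃⟩
  · rintro ⟨rfl, rfl⟩
    simp

/-- In the multinomial expansion, the ū- and X-exponents both record how often each G_i was chosen.
-/
theorem coeff_interaction_pow (G : Fin n → MvPowerSeries (Fin n) R) (k : ℕ)
    (a b c : Fin n →₀ ℕ) :
    coeff (triple a b c)
      ((∑ i, X (Var.ubar i) * X (Var.x i) * inU (G i) : MvPowerSeries (Var n) R) ^ k) =
      if a = c ∧ k = a.degree then Nat.multinomial Finset.univ a * coeff b (mpow G a) else 0 := by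
  classical
  have hterm : ∀ κ : Fin n → ℕ,
      ∏ i, (X (Var.ubar i) * X (Var.x i) * inU (G i) : MvPowerSeries (Var n) R) ^ κ i =
      monomial (triple (Finsupp.equivFunOnFinite.symm κ) 0 (Finsupp.equivFunOnFinite.symm κ)) 1 *
        inU (mpow G (Finsupp.equivFunOnFinite.symm κ)) := fun κ => by
    rw [← mpow_X_mul_mpow_X_mul_mpow_X, ← mpow_inU]
    simp [mpow, mul_pow, Finset.prod_mul_distrib]
  rw [Finset.sum_pow_eq_sum_piAntidiag, map_sum]
  have hc : ∀ κ : Fin n → ℕ, coeff (triple a b c)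
      ((Nat.multinomial Finset.univ κ : MvPowerSeries (Var n) R) *
      ∏ i, (X (Var.ubar i) * X (Var.x i) * inU (G i) : MvPowerSeries (Var n) R) ^ κ i) =
      if κ = a then (if a = c then Nat.multinomial Finset.univ a * coeff b (mpow G a) else 0)
        else 0 := fun κ => by
    rw [hterm, ← map_natCast (C (σ := Var n) (R := R)), coeff_C_mul, coeff_monomial_mul_inU]
    by_cases h : κ = a
    · subst h
      have : (Finsupp.equivFunOnFinite.symm ⇑a) = a := Finsupp.equivFunOnFinite_symm_coe a
      simp [this, eq_comm]
    · have : a ≠ Finsupp.equivFunOnFinite.symm κ := by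
        rintro rfl
        exact h rfl
      simp [h, this]
  rw [Finset.sum_congr rfl fun κ _ => hc κ, Finset.sum_ite_eq', Finsupp.degree_eq_sum]
  by_cases h : a = c <;> simp [h, Finset.mem_piAntidiag, eq_comm]

theorem coeff_expInteraction [Algebra ℚ R] (G : Fin n → MvPowerSeries (Fin n) R)
    (a b c : Fin n →₀ ℕ) :
    coeff (triple a b c) (expInteraction G) =
      if a = c then algebraMap ℚ R (1 / mfactorial a) * coeff b (mpow G a) else 0 := by
  have hs : PowerSeries.HasSubst
      (∑ i, X (Var.ubar i) * X (Var.x i) * inU (G i) : MvPowerSeries (Var n) R) :=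
    PowerSeries.HasSubst.of_constantCoeff_zero (by simp)
  rw [expInteraction, PowerSeries.coeff_subst hs]
  simp only [coeff_interaction_pow, PowerSeries.coeff_exp, smul_eq_mul]
  split_ifs with h
  -- Only the power k = |a| contributes, and 1/|a|! times the multinomial coefficient is 1/a!.
  · rw [finsum_eq_single _ a.degree fun k hk => by simp [hk]]
    rw [if_pos ⟨h, rfl⟩, ← mul_assoc, ← map_natCast (algebraMap ℚ R), ← map_mul]
    congr 2
    have hm := Nat.multinomial_spec Finset.univ a
    rw [← Finsupp.degree_eq_sum] at hm
    rw [← hm, mfactorial]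
    have h1 : ((∏ i, (a i).factorial : ℕ) : ℚ) ≠ 0 :=
      Nat.cast_ne_zero.2 (Finset.prod_ne_zero_iff.2 fun i _ => Nat.factorial_ne_zero _)
    have h2 : ((Nat.multinomial Finset.univ a : ℕ) : ℚ) ≠ 0 :=
      Nat.cast_ne_zero.2 (Nat.multinomial_pos _ _).ne'
    rw [Nat.cast_mul]
    field_simp
  · simp [h]

theorem coeff_mpow_u_mul_expInteraction [Algebra ℚ R] (G : Fin n → MvPowerSeries (Fin n) R)
    (β a b c : Fin n →₀ ℕ) :
    coeff (triple a b c) (mpow (fun i => X (Var.u i)) β * expInteraction G) =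
      if a = c then algebraMap ℚ R (1 / mfactorial a) * coeff b (mpow X β * mpow G a) else 0 := by
  classical
  have hmon : mpow (fun i => (X (Var.u i) : MvPowerSeries (Var n) R)) β =
      monomial (triple 0 β 0) 1 := by
    rw [← mpow_X_mul_mpow_X_mul_mpow_X]
    simp [mpow]
  rw [hmon, mpow_X, coeff_monomial_mul, coeff_monomial_mul, triple_sub_triple,
    coeff_expInteraction]
  simp only [triple_le_triple, zero_le, true_and, and_true, tsub_zero, one_mul]
  by_cases h : a = c <;> by_cases h' : β ≤ b <;> simp [h, h']

theorem coeff_mpow_ubar_mul_mpow_u_mul_inU (G : Fin n → MvPowerSeries (Fin n) R)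
    (α β a b c : Fin n →₀ ℕ) :
    coeff (triple a b c) (mpow (fun i => X (Var.ubar i)) α * mpow (fun i => X (Var.u i)) β *
      mpow (fun i => inU (G i)) α) =
      if a = α ∧ c = 0 then coeff b (mpow X β * mpow G α) else 0 := by
  have hmon : mpow (fun i => (X (Var.ubar i) : MvPowerSeries (Var n) R)) α =
      monomial (triple α 0 0) 1 := by
    rw [← mpow_X_mul_mpow_X_mul_mpow_X]
    simp [mpow]
  rw [mpow_inU, mpow_X_u, mul_assoc, ← inU_mul, hmon, coeff_monomial_mul_inU]

theorem formallySummable_monomial {σ : Type*} (f : (σ →₀ ℕ) → R) :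
    FormallySummable fun α => monomial α (f α) := by
  classical
  refine fun d => (Set.finite_singleton d).subset fun α hα => ?_
  by_contra hne
  exact hα (coeff_monomial_ne (Ne.symm hne) _)

theorem coeff_formalSum_monomial {σ : Type*} (f : (σ →₀ ℕ) → R) (d : σ →₀ ℕ) :
    coeff d (formalSum fun α => monomial α (f α)) = f d := by
  change ∑ᶠ α, coeff d (monomial α (f α)) = f d
  rw [finsum_eq_single _ d fun α hα => coeff_monomial_ne hα.symm _, coeff_monomial_same]

theorem gaussianIntegral_mpow_ubar_mul (G : Fin n → MvPowerSeries (Fin n) R)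
    (α β : Fin n →₀ ℕ) :
    GaussianIntegrable 1 (mpow (fun i => X (Var.ubar i)) α * mpow (fun i => X (Var.u i)) β *
        mpow (fun i => inU (G i)) α) ∧
      gaussianIntegral 1 (mpow (fun i => X (Var.ubar i)) α * mpow (fun i => X (Var.u i)) β *
        mpow (fun i => inU (G i)) α) = C (derivAtZero α (mpow X β * mpow G α)) := by
  classical
  obtain ⟨h₁, h₂⟩ := gaussianIntegrable_of_forall_ne
    (U := mpow (fun i => X (Var.ubar i)) α * mpow (fun i => X (Var.u i)) β *
        mpow (fun i => inU (G i)) α) (fun _ => α) fun a b c ha => by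
      rw [coeff_mpow_ubar_mul_mpow_u_mul_inU, if_neg fun h => ha h.1]
  refine ⟨h₁, ?_⟩
  ext d
  rw [h₂, coeff_mpow_ubar_mul_mpow_u_mul_inU, coeff_C, derivAtZero_eq]
  by_cases h : d = 0 <;> simp [h, mul_comm]

variable [Algebra ℚ R]

theorem algebraMap_one_div_mfactorial_mul (α : Fin n →₀ ℕ) :
    algebraMap ℚ R (1 / mfactorial α) * mfactorial α = 1 := by
  have h : ((mfactorial α : ℕ) : ℚ) ≠ 0 :=
    Nat.cast_ne_zero.2 (Finset.prod_ne_zero_iff.2 fun i _ => Nat.factorial_ne_zero _)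
  rw [← map_natCast (algebraMap ℚ R), ← map_mul, one_div_mul_cancel h, map_one]

/-- The Wick factor α! cancels the 1/α! of the exponential. -/
theorem gaussianIntegral_mpow_u_mul_expInteraction (G : Fin n → MvPowerSeries (Fin n) R)
    (β : Fin n →₀ ℕ) :
    GaussianIntegrable 1 (mpow (fun i => X (Var.u i)) β * expInteraction G) ∧
      gaussianIntegral 1 (mpow (fun i => X (Var.u i)) β * expInteraction G) =
        lagrangeSeries G (mpow X β) := by
  obtain ⟨h₁, h₂⟩ := gaussianIntegrable_of_forall_ne
    (U := mpow (fun i => X (Var.u i)) β * expInteraction G) id fun a b c hac => by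
      rw [coeff_mpow_u_mul_expInteraction, if_neg (id hac : a ≠ c)]
  refine ⟨h₁, ?_⟩
  ext d
  rw [h₂, id, coeff_mpow_u_mul_expInteraction, if_pos rfl, coeff_lagrangeSeries, mul_right_comm,
    algebraMap_one_div_mfactorial_mul, one_mul]

end Interaction

end LagrangeGood

/-! ### The Lagrange–Good formula -/

theorem theorem9 {R : Type*} [CommRing R] [Algebra ℚ R] (n : ℕ)
    (G : Fin n → MvPowerSeries (Fin n) R) :
    (∃! F : Fin n → MvPowerSeries (Fin n) R, IsImplicitSolution G F) ∧
    ∀ F : Fin n → MvPowerSeries (Fin n) R, IsImplicitSolution G F →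
      IsUnit (1 - xJacobian G F).det ∧
      ∀ β : Fin n →₀ ℕ,
        -- the integral converges, and equals `Ω(F) / det(I - X∂G(F))` for `Ω(u) = u^β`
        GaussianIntegrable 1
          (mpow (fun i => MvPowerSeries.X (Var.u i)) β * expInteraction G) ∧
        mpow F β * Ring.inverse (1 - xJacobian G F).det =
          gaussianIntegral 1
            (mpow (fun i => MvPowerSeries.X (Var.u i)) β * expInteraction G) ∧
        -- each coefficient of the expansion is a well-defined integral with values in `R`
        (∀ α : Fin n →₀ ℕ,
          GaussianIntegrable 1
            (mpow (fun i => MvPowerSeries.X (Var.ubar i)) α *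
              mpow (fun i => MvPowerSeries.X (Var.u i)) β * mpow (fun i => inU (G i)) α) ∧
          gaussianIntegral 1
            (mpow (fun i => MvPowerSeries.X (Var.ubar i)) α *
              mpow (fun i => MvPowerSeries.X (Var.u i)) β * mpow (fun i => inU (G i)) α) =
            MvPowerSeries.C (derivAtZero α (mpow MvPowerSeries.X β * mpow G α))) ∧
        -- the expansion `∑_α X^α / α! · ∂^α|_{u=0} [Ω(u) G(u)^α]`
        FormallySummable (fun α : Fin n →₀ ℕ =>
          MvPowerSeries.monomial α (algebraMap ℚ R (1 / (mfactorial α : ℚ)) *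
            derivAtZero α (mpow MvPowerSeries.X β * mpow G α))) ∧
        gaussianIntegral 1
            (mpow (fun i => MvPowerSeries.X (Var.u i)) β * expInteraction G) =
          formalSum (fun α : Fin n →₀ ℕ =>
            MvPowerSeries.monomial α (algebraMap ℚ R (1 / (mfactorial α : ℚ)) *
              derivAtZero α (mpow MvPowerSeries.X β * mpow G α))) := by
  refine ⟨existsUnique_isImplicitSolution G, fun F hF => ⟨isUnit_det_one_sub_xJacobian hF,
    fun β => ?_⟩⟩
  obtain ⟨hint, hval⟩ := gaussianIntegral_mpow_u_mul_expInteraction G β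
  refine ⟨hint, ?_, fun α => gaussianIntegral_mpow_ubar_mul G α β, formallySummable_monomial _, ?_⟩
  · have hs := hasSubst_of_isImplicitSolution hF
    have hF' : MvPowerSeries.subst F (mpow (MvPowerSeries.X (R := R)) β) = mpow F β := by
      have h := map_mpow (MvPowerSeries.substAlgHom (R := R) hs).toRingHom MvPowerSeries.X β
      simpa [MvPowerSeries.subst_X hs] using h
    rw [hval, lagrangeSeries_eq_subst_mul_inverse_det hF, hF']
  · rw [hval]
    ext d
    rw [coeff_formalSum_monomial, derivAtZero_eq, coeff_lagrangeSeries, ← mul_assoc,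
      algebraMap_one_div_mfactorial_mul, one_mul]
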